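/- Let $G$ be a countably infinite group and let $H_1\supseteq H_2\supseteq\cdots$ be a decreasing sequence of normal subgroups of finite index in $G$ with $\bigcap_n H_n=\{e\}$ (so $G$ is residually finite). Let $\Sigma=\{\sigma_n\colon G\to\operatorname{Sym}(G/H_n)\}_n$ be the sofic approximation of $G$ given by the natural action on cosets, $\sigma_n(g)(cH_n)=cg^{-1}H_n$. Then for every integer $k\ge 2$ and every real $\kappa\in[0,1)$ there is an element $x\in k^G=\{1,\dots,k\}^G$ which is Toeplitz with respect to $(H_n)$ and satisfies $$h_\Sigma(\overline{Gx},G)=\kappa\log k .$$ Here $k^G$ carries the product topology and the shift action $(gx)_h=x_{g^{-1}h}$, and $\overline{Gx}$ is the orbit closure of $x$. The element $x$ is Toeplitz with respect to $(H_n)$ if for every $g\in G$ there is an $n$ such that $x_{h^{-1}g}=x_g$ for all $h\in H_n$. For a continuous pseudometric $d$ on a compact metrizable $G$-space $X$ and a sofic approximation $\Sigma=\{\sigma_n\colon G\to\operatorname{Sym}(V_n)\}$, put $$h_\Sigma(d)=\sup_{\epsilon>0}\ \inf_{F\subset G\text{ finite}}\ \inf_{\delta>0}\ \limsup_{n\to\infty}\frac1{|V_n|}\log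 N_\epsilon\big(\mathrm{Map}(d,F,\delta,\sigma_n),d_\infty\big)\qquad(\log 0=-\infty),$$ where $\mathrm{Map}(d,F,\delta,\sigma)$ is the set of maps $\varphi\colon V\to X$ with $\big(\frac1{|V|}\sum_{v\in V}d(\varphi(\sigma(s)v),s\varphi(v))^2\big)^{1/2}\le\delta$ for all $s\in F$, $d_\infty(\varphi,\psi)=\max_{v}d(\varphi(v),\psi(v))$, and $N_\epsilon(Y,\rho)$ is the maximal cardinality of a subset of $Y$ whose distinct points have $\rho$-distance $>\epsilon$. The sofic topological entropy $h_\Sigma(X,G)$ is the common value of $h_\Sigma(d)$ over all continuous pseudometrics $d$ on $X$ that are dynamically generating, i.e. such that for all $x\ne y$ in $X$ there is $s\in G$ with $d(sx,sy)>0$. -/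

import Mathlib

open Filter Topology

namespace SoficDynamics

universe u v w

/-! ### Sofic approximations -/

/-- A sofic approximation of a group `G`: a sequence of maps `σ n : G → Sym (V n)` into the
permutation groups of finite sets which is asymptotically multiplicative and asymptotically
free. -/
structure SoficApproximation (G : Type u) [Group G] where
  /-- the finite sets -/
  V : ℕ → Type v
  /-- the sets are finite -/
  fintypeV : ∀ n, Fintype (V n)
  /-- the maps into the symmetric groups -/
  σ : ∀ n, G → Equiv.Perm (V n)
  asymptotically_mul : ∀ s t : G,
    Tendsto (fun n => (Nat.card {x : V n // σ n (s * t) x = σ n s (σ n t x)} : ℝ) /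
      (Nat.card (V n) : ℝ)) atTop (𝓝 1)
  asymptotically_free : ∀ s t : G, s ≠ t →
    Tendsto (fun n => (Nat.card {x : V n // σ n t x ≠ σ n s x} : ℝ) /
      (Nat.card (V n) : ℝ)) atTop (𝓝 1)

attribute [instance] SoficApproximation.fintypeV

/-- The sofic approximation given by the natural action on the cosets of a decreasing sequence
of normal subgroups of finite index with trivial intersection:
`σ n g (c H_n) = c g⁻¹ H_n`. -/
noncomputable def cosetApproximation {G : Type u} [Group G] (H : ℕ → Subgroup G)
    (hnormal : ∀ n, (H n).Normal) (hindex : ∀ n, (H n).FiniteIndex)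
    (hanti : Antitone H) (hinf : ⨅ n, H n = ⊥) : SoficApproximation.{u, u} G where
  V n := G ⧸ H n
  fintypeV n := Fintype.ofFinite (G ⧸ H n)
  σ n g := Equiv.mulRight ((g : G ⧸ H n)⁻¹)
  asymptotically_mul s t := by
    refine tendsto_const_nhds.congr fun n => ?_
    have h : ∀ x : G ⧸ H n, Equiv.mulRight (((s * t : G) : G ⧸ H n)⁻¹) x =
        Equiv.mulRight ((s : G ⧸ H n)⁻¹) (Equiv.mulRight ((t : G ⧸ H n)⁻¹) x) := by
      intro x
      simp [mul_assoc]
    rw [Nat.card_congr (Equiv.subtypeUnivEquiv h), div_self]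
    exact_mod_cast Nat.card_pos.ne'
  asymptotically_free s t hst := by
    have hex : ∃ m, t⁻¹ * s ∉ H m := by
      by_contra hcon
      push Not at hcon
      have : t⁻¹ * s ∈ (⨅ n, H n) := Subgroup.mem_iInf.2 hcon
      rw [hinf, Subgroup.mem_bot, inv_mul_eq_one] at this
      exact hst this.symm
    obtain ⟨m, hm⟩ := hex
    refine tendsto_const_nhds.congr' ?_
    filter_upwards [eventually_ge_atTop m] with n hn
    have h : ∀ x : G ⧸ H n, Equiv.mulRight ((t : G ⧸ H n)⁻¹) x ≠
        Equiv.mulRight ((s : G ⧸ H n)⁻¹) x := by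
      intro x hx
      have hx' : (t : G ⧸ H n) = (s : G ⧸ H n) := by simpa using hx
      exact hm (hanti hn (QuotientGroup.eq.1 hx'))
    rw [Nat.card_congr (Equiv.subtypeUnivEquiv h), div_self]
    exact_mod_cast Nat.card_pos.ne'

/-! ### Sofic topological entropy -/

/-- A continuous pseudometric on a topological space. -/
structure ContPseudometric (X : Type w) [TopologicalSpace X] where
  /-- the distance function -/
  d : X → X → ℝ
  self : ∀ x, d x x = 0
  symm : ∀ x y, d x y = d y x
  triangle : ∀ x y z, d x z ≤ d x y + d y z
  cont : Continuous fun p : X × X => d p.1 p.2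

/-- A pseudometric `d` on a `G`-space is dynamically generating if distinct points `x`, `y`
satisfy `d (s x) (s y) > 0` for some `s`. -/
def ContPseudometric.IsDynGenerating (G : Type u) [Group G] {X : Type w} [TopologicalSpace X]
    [MulAction G X] (ρ : ContPseudometric X) : Prop :=
  ∀ x y : X, x ≠ y → ∃ s : G, 0 < ρ.d (s • x) (s • y)

section Entropy

variable {G : Type u} [Group G] {X : Type w}

/-- `d₂(φ, ψ) = (|V|⁻¹ ∑ v, d(φ v, ψ v)²)^{1/2}`. -/
noncomputable def dist2 (d : X → X → ℝ) {V : Type v} [Fintype V] (φ ψ : V → X) : ℝ :=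
  Real.sqrt ((∑ x : V, d (φ x) (ψ x) ^ 2) / (Fintype.card V : ℝ))

/-- `d_∞(φ, ψ) = max_v d(φ v, ψ v)`. -/
noncomputable def distSup (d : X → X → ℝ) {V : Type v} [Fintype V] (φ ψ : V → X) : ℝ :=
  ⨆ x : V, d (φ x) (ψ x)

/-- `Map(d, F, δ, σ)`: the maps `φ : V → X` with `d₂(φ ∘ σ_s, s • φ) ≤ δ` for all `s ∈ F`. -/
def mapSet [MulAction G X] (d : X → X → ℝ) (F : Finset G) (δ : ℝ) {V : Type v} [Fintype V]
    (σ : G → Equiv.Perm V) : Set (V → X) :=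
  {φ | ∀ s ∈ F, dist2 d (fun x => φ (σ s x)) (fun x => s • φ x) ≤ δ}

/-- `N_ε(Y, ρ)`: the largest cardinality of a `(ρ, ε)`-separated subset of `Y`. -/
noncomputable def sepNumber {A : Type w} (ε : ℝ) (Y : Set A) (ρ : A → A → ℝ) : ℕ∞ :=
  ⨆ (E : Set A) (_ : E ⊆ Y ∧ ∀ y ∈ E, ∀ z ∈ E, y ≠ z → ε < ρ y z), E.encard

/-- `h_Σ(d) = sup_{ε>0} inf_F inf_{δ>0} limsup_n |V_n|⁻¹ log N_ε(Map(d, F, δ, σ_n), d_∞)`,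
where `log 0 = -∞`. -/
noncomputable def entropyOf [TopologicalSpace X] [MulAction G X]
    (S : SoficApproximation.{u, v} G) (ρ : ContPseudometric X) : EReal :=
  ⨆ (ε : ℝ) (_ : 0 < ε), ⨅ (F : Finset G), ⨅ (δ : ℝ) (_ : 0 < δ),
    limsup (fun n =>
      ENNReal.log
        ((sepNumber ε (mapSet ρ.d F δ (S.σ n)) (distSup ρ.d) : ℕ∞) : ENNReal) /
      ((Fintype.card (S.V n) : ℝ) : EReal)) atTop

/-- `h` is the sofic topological entropy of the system `(X, G)` with respect to `S`: it is the
common value of `h_Σ(d)` over all dynamically generating continuous pseudometrics `d` on `X`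
(and there is such a pseudometric). -/
def IsSoficEntropy (S : SoficApproximation.{u, v} G) (X : Type w) [TopologicalSpace X]
    [MulAction G X] (h : EReal) : Prop :=
  (∃ ρ : ContPseudometric X, ρ.IsDynGenerating G) ∧
    ∀ ρ : ContPseudometric X, ρ.IsDynGenerating G → entropyOf S ρ = h

end Entropy

/-! ### Shifts and Toeplitz elements -/

/-- The full shift `k^G`, with the product topology, each factor being discrete. -/
abbrev FullShift (G : Type u) (k : ℕ) : Type u := G → Fin k

/-- The shift action `(g x)_h = x_{g⁻¹ h}`. -/
instance (G : Type u) [Group G] (k : ℕ) : MulAction G (FullShift G k) where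
  smul g x := fun h => x (g⁻¹ * h)
  one_smul x := by
    funext h
    change x (1⁻¹ * h) = x h
    simp
  mul_smul a b x := by
    funext h
    change x ((a * b)⁻¹ * h) = x (b⁻¹ * (a⁻¹ * h))
    simp [mul_assoc]

instance (G : Type u) [Group G] (k : ℕ) : ContinuousConstSMul G (FullShift G k) where
  continuous_const_smul g :=
    continuous_pi fun h => continuous_apply (A := fun _ : G => Fin k) (g⁻¹ * h)

/-- The orbit closure of `x ∈ k^G`, with the restricted action. -/
def orbitClosure {G : Type u} [Group G] {k : ℕ} (x : FullShift G k) :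
    SubMulAction G (FullShift G k) where
  carrier := closure (MulAction.orbit G x)
  smul_mem' g y hy := by
    refine map_mem_closure (continuous_const_smul g) hy fun z hz => ?_
    obtain ⟨a, rfl⟩ := hz
    exact ⟨g * a, mul_smul g a x⟩

/-- The `H`-periodic part of `x`. -/
def per {G : Type u} [Group G] {k : ℕ} (H : Subgroup G) (x : FullShift G k) : Set G :=
  {g | ∀ h ∈ H, x (h⁻¹ * g) = x g}

/-- `x` is a Toeplitz element with respect to the sequence `H`: every element of `G` lies in the
`H n`-periodic part of `x` for some `n`. -/
def IsToeplitz {G : Type u} [Group G] {k : ℕ} (H : ℕ → Subgroup G) (x : FullShift G k) : Prop :=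
  ⋃ n, per (H n) x = Set.univ

end SoficDynamics

namespace SoficDynamics

/-! The point `x` is a union of periodic partial configurations whose proportion of holes decreases
to `κ`. At each stage the period is deepened, and only about `κ` of the cells remain holes. The
cells filled in are coloured so that every translate of every filling of the previous stage appears
through a growing finite window (`exists_refines`, `exists_config_of_refinements`). Every position
is eventually filled, and this makes `x` Toeplitz.

Lower bound: on `G ⧸ H n`, with `n` the level of a late stage, each of the `k ^ holes` fillings has
all its windows realised by translates of `x`. Reading these windows coset by coset gives exactly
equivariant colour patterns, hence separated microstates (`exists_card_le_sepNumber`,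
`le_entropyOf_of_fillings`).

Upper bound: every point of the orbit closure extends a translate of each stage `s`. A microstate is
almost determined by its colours at the identity coordinate, and away from a few bad vertices these
colours cohere along finite windows (`exists_mapSet_card_bad_le`). Hence one translate of `s`,
recorded at each member of a sparse set, predicts the colours on a whole neighbourhood except at
holes. The translates and the bad vertices cost arbitrarily little, so the entropy is at most the
hole proportion of `s` times `log k` (`sepNumber_le`, `entropyOf_le_holes`). Letting the stage grow
gives `κ log k`. -/

/-! ### Counting in finite quotients and disjoint translates -/

/-- A section `r` of a group homomorphism `π : A →* Q` identifies `A` with `Q × ker π`. -/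
def splitEquiv {A Q : Type*} [Group A] [Group Q] (π : A →* Q) (r : Q → A)
    (hr : ∀ q, π (r q) = q) : A ≃ Q × π.ker where
  toFun u := (π u, ⟨u * (r (π u))⁻¹, by simp [MonoidHom.mem_ker, hr]⟩)
  invFun p := p.2 * r p.1
  left_inv u := by simp
  right_inv p := by
    obtain ⟨q, u, hu⟩ := p
    have hu' : π u = 1 := hu
    ext <;> simp [hr, hu']

theorem card_eq_card_mul_card_ker {A Q : Type*} [Group A] [Group Q] (π : A →* Q)
    (hπ : Function.Surjective π) : Nat.card A = Nat.card Q * Nat.card π.ker := by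
  obtain ⟨r, hr⟩ := hπ.hasRightInverse
  rw [Nat.card_congr (splitEquiv π r hr), Nat.card_prod]

/-- All fibres of `π` have the size of the kernel, so densities are preserved under pullback. This
keeps the hole proportion unchanged when a configuration is viewed at a deeper level. -/
theorem card_preimage_mul_card {A Q : Type*} [Group A] [Group Q] (π : A →* Q)
    (hπ : Function.Surjective π) (P : Q → Prop) :
    Nat.card {a // P (π a)} * Nat.card Q = Nat.card {q // P q} * Nat.card A := by
  obtain ⟨r, hr⟩ := hπ.hasRightInverse
  have e : {a // P (π a)} ≃ {q // P q} × π.ker :=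
    ((splitEquiv π r hr).subtypeEquiv (q := fun p => P p.1) fun _ => Iff.rfl).trans
      { toFun := fun p => (⟨p.1.1, p.2⟩, p.1.2)
        invFun := fun p => ⟨(p.1.1, p.2), p.1.2⟩
        left_inv := fun _ => rfl
        right_inv := fun _ => rfl }
  rw [card_eq_card_mul_card_ker π hπ, Nat.card_congr e, Nat.card_prod]
  ring

theorem infinite_of_finiteIndex {G : Type*} [Group G] [Infinite G] (K : Subgroup G)
    [K.FiniteIndex] : Infinite K := by
  by_contra hf
  rw [not_infinite_iff_finite] at hf
  exact not_finite_iff_infinite.2 ‹Infinite G›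
    (Nat.finite_of_card_ne_zero (by
      rw [Subgroup.card_eq_card_quotient_mul_card_subgroup K]
      exact mul_ne_zero Nat.card_pos.ne' Nat.card_pos.ne'))

/-- Given infinite sets `S i` indexed by a finite type, one can choose elements `b i ∈ S i` such
that the translates `b i * F` of a given finite set are pairwise disjoint. -/
theorem exists_disjoint_translates {G ι : Type*} [Group G] [Finite ι] (S : ι → Set G)
    (hS : ∀ i, (S i).Infinite) (F : Finset G) :
    ∃ b : ι → G, (∀ i, b i ∈ S i) ∧
      ∀ i j, i ≠ j → ∀ g ∈ F, ∀ g' ∈ F, b i * g ≠ b j * g' := by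
  classical
  have := Fintype.ofFinite ι
  suffices h : ∀ s : Finset ι, ∃ b : ι → G, (∀ i, b i ∈ S i) ∧
      ∀ i ∈ s, ∀ j ∈ s, i ≠ j → ∀ g ∈ F, ∀ g' ∈ F, b i * g ≠ b j * g' by
    obtain ⟨b, hb, h⟩ := h Finset.univ
    exact ⟨b, hb, fun i j => h i (Finset.mem_univ i) j (Finset.mem_univ j)⟩
  intro s
  induction s using Finset.induction_on with
  | empty =>
    choose b hb using fun i => (hS i).nonempty
    exact ⟨b, hb, by simp⟩
  | insert a s ha ih =>
    obtain ⟨b, hb, h⟩ := ih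
    -- A collision `z * g = b j * g'` forces `z = b j * g' * g⁻¹`, so only finitely many `z` are
    -- excluded.
    obtain ⟨z, hz, hz'⟩ := (hS a).exists_notMem_finset
      ((s ×ˢ (F ×ˢ F)).image fun t => b t.1 * t.2.1 * t.2.2⁻¹)
    have key : ∀ j ∈ s, ∀ g ∈ F, ∀ g' ∈ F, z * g ≠ b j * g' := by
      intro j hj g hg g' hg' he
      refine hz' (Finset.mem_image.2 ⟨(j, g', g), by simp [hj, hg, hg'], ?_⟩)
      simp [← he]
    refine ⟨Function.update b a z, fun i => ?_, fun i hi j hj hij g hg g' hg' => ?_⟩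
    · by_cases hi : i = a
      · subst hi; simpa using hz
      · simpa [hi] using hb i
    · by_cases hia : i = a
      · have hja : j ≠ a := fun h => hij (hia.trans h.symm)
        have hj' : j ∈ s := (Finset.mem_insert.1 hj).resolve_left hja
        subst hia
        simpa [hja] using key j hj' g hg g' hg'
      · have hi' : i ∈ s := (Finset.mem_insert.1 hi).resolve_left hia
        by_cases hja : j = a
        · subst hja
          simpa [hia] using (key i hi' g' hg' g hg).symm
        · have hj' : j ∈ s := (Finset.mem_insert.1 hj).resolve_left hja
          simpa [hia, hja] using h i hi' j hj' hij g hg g' hg'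

section Chain

variable {G : Type*} [Group G] {H : ℕ → Subgroup G}

/-- Along a decreasing sequence of subgroups with trivial intersection, a finite set is
eventually mapped injectively into the coset space. -/
theorem eventually_injOn_mk (hanti : Antitone H) (hinf : ⨅ n, H n = ⊥) (P : Finset G) :
    ∀ᶠ n in atTop, Set.InjOn (fun g : G => (g : G ⧸ H n)) P := by
  have h : ∀ a ∈ P, ∀ b ∈ P, ∀ᶠ n in atTop, (a : G ⧸ H n) = b → a = b := by
    intro a _ b _
    by_cases hab : a = b
    · exact Eventually.of_forall fun _ _ => hab
    have hex : ∃ m, a⁻¹ * b ∉ H m := by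
      by_contra! hcon
      have : a⁻¹ * b ∈ ⨅ n, H n := Subgroup.mem_iInf.2 hcon
      rw [hinf, Subgroup.mem_bot, inv_mul_eq_one] at this
      exact hab this
    obtain ⟨m, hm⟩ := hex
    filter_upwards [eventually_ge_atTop m] with n hn he
    exact absurd (hanti hn (QuotientGroup.eq.1 he)) hm
  have h2 := (Finset.eventually_all P).2 fun a ha => (Finset.eventually_all P).2 (h a ha)
  filter_upwards [h2] with n hn a ha b hb he
  exact hn a ha b hb he

variable (hindex : ∀ n, (H n).FiniteIndex)
include hindex

theorem tendsto_card_quotient [Infinite G] (hanti : Antitone H) (hinf : ⨅ n, H n = ⊥) :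
    Tendsto (fun n => Nat.card (G ⧸ H n)) atTop atTop := by
  refine tendsto_atTop.2 fun b => ?_
  obtain ⟨P, hP⟩ := Infinite.exists_subset_card_eq G b
  filter_upwards [eventually_injOn_mk hanti hinf P] with n hn
  have := hindex n
  have h1 := Set.encard_le_encard_of_injOn (Set.mapsTo_univ _ _) hn
  rw [Set.encard_coe_eq_coe_finsetCard, hP, Set.encard_univ, ENat.card_eq_coe_natCard] at h1
  exact_mod_cast h1

end Chain

/-! ### Partial configurations and the construction of the Toeplitz point -/

/-- A partially defined configuration which is invariant under `H n`. -/
structure PartialConfig {G : Type*} [Group G] (H : ℕ → Subgroup G) (k : ℕ) where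
  /-- the level -/
  n : ℕ
  /-- the values on the cosets of `H n`, with `none` for a hole -/
  p : G ⧸ H n → Option (Fin k)

namespace PartialConfig

variable {G : Type*} [Group G] {H : ℕ → Subgroup G} {k : ℕ}

/-- The number of holes of a partial configuration in a period. -/
noncomputable def holes (s : PartialConfig H k) : ℕ := Nat.card {q // s.p q = none}

/-- The size of the period of a partial configuration. -/
noncomputable def size (s : PartialConfig H k) : ℕ := Nat.card (G ⧸ H s.n)

/-- A full configuration of the same period which extends a partial one. -/
def IsFilling (s : PartialConfig H k) (c : G ⧸ H s.n → Fin k) : Prop :=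
  ∀ q a, s.p q = some a → c q = a

/-- There are a finite set `P` containing `F` and values on `P`, such that every translate of every
configuration with the period of `s` is seen in `P` through the window `F`. -/
theorem exists_windows [Infinite G] [Nonempty (Fin k)] [∀ n, (H n).FiniteIndex]
    [∀ n, (H n).Normal]
    (s : PartialConfig H k) (F : Finset G) :
    ∃ (P : Finset G) (f : G → Fin k), F ⊆ P ∧
      ∀ (c : G ⧸ H s.n → Fin k) (a : G), ∃ b : G, (b : G ⧸ H s.n) = a ∧
        ∀ g ∈ F, b * g ∈ P ∧ f (b * g) = c ((a * g : G) : G ⧸ H s.n) := by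
  classical
  have := infinite_of_finiteIndex (H s.n)
  -- One index for each pair (configuration, coset): the candidates for `b i` are the
  -- representatives of the coset, infinitely many since `H s.n` is infinite. Disjointness of the
  -- sets `b i * F` lets `f` copy a different configuration on each of them.
  obtain ⟨b, hb, hdisj⟩ := exists_disjoint_translates
    (ι := (G ⧸ H s.n → Fin k) × (G ⧸ H s.n)) (fun i => {g : G | (g : G ⧸ H s.n) = i.2})
    (fun i => by
      refine Set.infinite_of_injective_forall_mem (f := fun h : H s.n => i.2.out * (h : G)) ?_ ?_
      · intro h h' he
        exact Subtype.ext (mul_left_cancel he)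
      · intro h
        simp) F
  have := Fintype.ofFinite (G ⧸ H s.n)
  refine ⟨F ∪ (Finset.univ ×ˢ F).image fun t : ((G ⧸ H s.n → Fin k) × (G ⧸ H s.n)) × G =>
    b t.1 * t.2, fun x => if h : ∃ i : (G ⧸ H s.n → Fin k) × (G ⧸ H s.n), ∃ g ∈ F, x = b i * g
      then h.choose.1 ((x : G) : G ⧸ H s.n) else Classical.arbitrary _,
    Finset.subset_union_left, fun c a => ⟨b (c, a), hb (c, a), fun g hg => ⟨?_, ?_⟩⟩⟩
  · refine Finset.mem_union_right _ (Finset.mem_image.2 ⟨((c, a), g), by simp [hg], rfl⟩)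
  · have hex : ∃ i : (G ⧸ H s.n → Fin k) × (G ⧸ H s.n), ∃ g' ∈ F, b (c, a) * g = b i * g' :=
      ⟨(c, a), g, hg, rfl⟩
    have hi : hex.choose = (c, (a : G ⧸ H s.n)) := by
      by_contra hne
      obtain ⟨g', hg', he⟩ := hex.choose_spec
      exact hdisj _ _ (Ne.symm hne) g hg g' hg' he
    have hba : ((b (c, a) : G) : G ⧸ H s.n) = a := hb (c, a)
    beta_reduce
    rw [dif_pos hex, hi, QuotientGroup.mk_mul, hba, QuotientGroup.mk_mul]

/-- `t` is a refinement of `s` at a deeper level: it extends `s`, has no holes in `F`, shows every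
translate of every filling of `s` through the window `F`, and the proportion of holes is just
above `κ`. -/
structure Refines (κ : ℝ) (F : Finset G) (s t : PartialConfig H k) : Prop where
  lt : s.n < t.n
  extend : ∀ (g : G) (a : Fin k), s.p g = some a → t.p g = some a
  lt_holes : κ * t.size < t.holes
  holes_le : (t.holes : ℝ) ≤ κ * t.size + 1
  filled : ∀ g ∈ F, t.p (g : G) ≠ none
  window : ∀ c, s.IsFilling c → ∀ a : G, ∃ b : G,
    ∀ g ∈ F, t.p ((b * g : G) : G ⧸ H t.n) = some (c ((a * g : G) : G ⧸ H s.n))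

/-- The set `P` carrying all required windows has a size independent of the new level. At a deep
enough level it embeds in the quotient and is smaller than the surplus of holes over `κ`, so the new
holes can all be placed off `P`. On `P` the values of `s` are kept and `f` fills the rest; as the
windows of `f` come from fillings of `s`, the two never conflict there. -/
theorem exists_refines [Infinite G] [Nonempty (Fin k)] [hindex : ∀ n, (H n).FiniteIndex]
    [∀ n, (H n).Normal] (hanti : Antitone H) (hinf : ⨅ n, H n = ⊥) {κ : ℝ} (hκ : 0 ≤ κ)
    (s : PartialConfig H k) (hs : κ * s.size < s.holes) (F : Finset G) :
    ∃ t, Refines κ F s t := by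
  classical
  obtain ⟨P, f, hFP, hP⟩ := s.exists_windows F
  have hsize : (0 : ℝ) < s.size := by exact_mod_cast Nat.card_pos
  -- The strict inequality `hs` makes this surplus positive; it is what pays for filling `P`.
  set gap : ℝ := s.holes / s.size - κ with hgap
  have hgap0 : 0 < gap := by rw [hgap, sub_pos, lt_div_iff₀ hsize]; exact hs
  have hlarge := (tendsto_natCast_atTop_atTop (R := ℝ)).comp
    (tendsto_card_quotient hindex hanti hinf)
  obtain ⟨n, hninj, hn, hnlt⟩ := ((eventually_injOn_mk hanti hinf P).and
    ((hlarge.eventually_ge_atTop ((P.card + 1) / gap)).and (eventually_gt_atTop s.n))).exists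
  simp only [Function.comp_apply] at hn
  rw [div_le_iff₀ hgap0] at hn
  set N := Nat.card (G ⧸ H n)
  let π : G ⧸ H n →* G ⧸ H s.n := QuotientGroup.map _ _ (MonoidHom.id G) (hanti hnlt.le)
  have hπ : ∀ g : G, π (g : G ⧸ H n) = g := fun g => rfl
  have hπs : Function.Surjective π := fun q => by
    obtain ⟨g, rfl⟩ := QuotientGroup.mk_surjective q
    exact ⟨g, rfl⟩
  have := Fintype.ofFinite (G ⧸ H n)
  let U₀ : Finset (G ⧸ H n) := Finset.univ.filter fun u => s.p (π u) = none
  let P' : Finset (G ⧸ H n) := P.image fun g : G => (g : G ⧸ H n)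
  have hU₀ : U₀.card * s.size = s.holes * N := by
    refine Eq.trans ?_ (card_preimage_mul_card π hπs (fun q => s.p q = none))
    rw [Nat.card_eq_fintype_card (α := {a // s.p (π a) = none}), Fintype.card_subtype]
    rfl
  have hU₀' : (U₀.card : ℝ) = (gap + κ) * N := by
    rw [hgap, sub_add_cancel, div_mul_eq_mul_div, eq_div_iff hsize.ne']
    exact_mod_cast hU₀
  have hP' : P'.card ≤ P.card := Finset.card_image_le
  -- The least integer exceeding `κ * N` is the number of holes kept: the surplus stays strictly
  -- positive, so the construction can be iterated, yet exceeds `κ * N` by at most one.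
  have hcard : ⌊κ * N⌋₊ + 1 ≤ (U₀ \ P').card := by
    have h1 : U₀.card ≤ (U₀ \ P').card + P'.card := by
      have := Finset.le_card_sdiff P' U₀
      omega
    have h2 : (⌊κ * N⌋₊ : ℝ) ≤ κ * N := Nat.floor_le (by positivity)
    have h1' : (U₀.card : ℝ) ≤ (U₀ \ P').card + P.card := by exact_mod_cast h1.trans (by omega)
    have : ((⌊κ * N⌋₊ + 1 : ℕ) : ℝ) ≤ (U₀ \ P').card := by
      push_cast
      nlinarith
    exact_mod_cast this
  obtain ⟨U, hU, hUcard⟩ := Finset.exists_subset_card_eq hcard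
  let f' : G ⧸ H n → Fin k := fun u => f (Function.invFunOn (fun g : G => (g : G ⧸ H n)) P u)
  have hf' : ∀ g ∈ P, f' (g : G) = f g := fun g hg => by
    simp only [f']
    rw [hninj.leftInvOn_invFunOn hg]
  let t : PartialConfig H k :=
    ⟨n, fun u => if u ∈ U then none else some ((s.p (π u)).getD (f' u))⟩
  have htU : ∀ u, u ∉ U → t.p u = some ((s.p (π u)).getD (f' u)) := fun u hu => if_neg hu
  have hPU : ∀ g ∈ P, (g : G ⧸ H n) ∉ U := fun g hg hgU =>
    (Finset.mem_sdiff.1 (hU hgU)).2 (Finset.mem_image_of_mem _ hg)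
  have htholes : t.holes = ⌊κ * N⌋₊ + 1 := by
    rw [← hUcard, holes]
    have : ∀ u, t.p u = none ↔ u ∈ U := fun u => by
      by_cases hu : u ∈ U <;> simp [t, hu]
    rw [Nat.card_congr (Equiv.subtypeEquivRight this)]
    simp
  refine ⟨t, hnlt, fun g a hga => ?_, ?_, ?_, fun g hg => ?_, fun c hc a => ?_⟩
  · rw [htU, hπ, hga]
    · rfl
    · intro hgU
      have := (Finset.mem_filter.1 (Finset.mem_sdiff.1 (hU hgU)).1).2
      rw [hπ, hga] at this
      cases this
  · rw [htholes]
    push_cast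
    exact Nat.lt_floor_add_one _
  · rw [htholes]
    push_cast
    have : (⌊κ * N⌋₊ : ℝ) ≤ κ * N := Nat.floor_le (by positivity)
    exact add_le_add_left this 1
  · rw [htU _ (hPU g (hFP hg))]
    simp
  · obtain ⟨b, hba, hb⟩ := hP c a
    refine ⟨b, fun g hg => ?_⟩
    obtain ⟨hbP, hbf⟩ := hb g hg
    rw [htU _ (hPU _ hbP), hf' _ hbP, hbf, hπ]
    have heq : ((b * g : G) : G ⧸ H s.n) = ((a * g : G) : G ⧸ H s.n) := by
      rw [QuotientGroup.mk_mul, hba, QuotientGroup.mk_mul]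
    rw [heq]
    cases hval : s.p ((a * g : G) : G ⧸ H s.n) with
    | none => rfl
    | some v => exact congrArg some (hc _ _ hval).symm

end PartialConfig

open PartialConfig in
/-- A configuration obtained as the union of a sequence of partial configurations, each of which
refines the preceding one. -/
theorem exists_config_of_refinements {G : Type*} [Group G] [Countable G] [Infinite G]
    {H : ℕ → Subgroup G} [∀ n, (H n).Normal] [hindex : ∀ n, (H n).FiniteIndex]
    (hanti : Antitone H) (hinf : ⨅ n, H n = ⊥) {k : ℕ} [Nonempty (Fin k)] {κ : ℝ}
    (hκ : κ ∈ Set.Ico (0 : ℝ) 1) :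
    ∃ (x : G → Fin k) (s : ℕ → PartialConfig H k), StrictMono (fun j => (s j).n) ∧
      (∀ j (g : G) a, (s j).p g = some a → x g = a) ∧
      (∀ g : G, ∃ j, (s j).p g ≠ none) ∧
      (∀ j, κ * (s j).size < (s j).holes) ∧
      (∀ j, ((s (j + 1)).holes : ℝ) ≤ κ * (s (j + 1)).size + 1) ∧
      ∀ K : Finset G, ∀ᶠ j in atTop, ∀ c, (s j).IsFilling c → ∀ a : G, ∃ b : G,
        ∀ g ∈ K, x (b * g) = c ((a * g : G) : G ⧸ H (s j).n) := by
  classical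
  obtain ⟨enum, henum⟩ := exists_surjective_nat G
  let F : ℕ → Finset G := fun j => (Finset.range (j + 1)).image enum
  have hF : ∀ K : Finset G, ∀ᶠ j in atTop, K ⊆ F j := fun K => by
    refine (Finset.eventually_all K).2 fun g _ => ?_
    obtain ⟨i, rfl⟩ := henum g
    filter_upwards [eventually_ge_atTop i] with j hj
    exact Finset.mem_image_of_mem _ (Finset.mem_range.2 (by omega))
  let T := {s : PartialConfig H k // κ * s.size < s.holes}
  choose nxt hnxt using fun (j : ℕ) (s : T) =>
    exists_refines hanti hinf hκ.1 s.1 s.2 (F j)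
  -- The recursion starts from the empty configuration, of hole proportion one; this is where `κ <
  -- 1` enters.
  have h0 : κ * (⟨0, fun _ => none⟩ : PartialConfig H k).size <
      (⟨0, fun _ => none⟩ : PartialConfig H k).holes := by
    have hpos : (0 : ℝ) < Nat.card (G ⧸ H 0) := by exact_mod_cast Nat.card_pos
    have hholes : (⟨0, fun _ => none⟩ : PartialConfig H k).holes = Nat.card (G ⧸ H 0) :=
      Nat.card_congr (Equiv.subtypeUnivEquiv fun _ => rfl)
    rw [hholes]
    exact mul_lt_of_lt_one_left hpos hκ.2
  let S : ℕ → T := fun j => Nat.rec ⟨⟨0, fun _ => none⟩, h0⟩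
    (fun j s => ⟨nxt j s, (hnxt j s).lt_holes⟩) j
  have hS : ∀ j, Refines κ (F j) (S j).1 (S (j + 1)).1 := fun j => hnxt j (S j)
  have hmono : ∀ i j, i ≤ j → ∀ (g : G) a, (S i).1.p g = some a → (S j).1.p g = some a := by
    intro i j hij g a hi
    induction j, hij using Nat.le_induction with
    | base => exact hi
    | succ j _ ih => exact (hS j).extend g a ih
  have hex : ∀ g : G, ∃ a j, (S j).1.p g = some a := fun g => by
    obtain ⟨j, hj⟩ := (hF {g}).exists
    obtain ⟨a, ha⟩ := Option.ne_none_iff_exists'.1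
      ((hS j).filled g (hj (Finset.mem_singleton_self g)))
    exact ⟨a, j + 1, ha⟩
  choose x hx using hex
  have hxs : ∀ j (g : G) a, (S j).1.p g = some a → x g = a := by
    intro j g a ha
    obtain ⟨i, hi⟩ := hx g
    have h1 := hmono i (max i j) (le_max_left _ _) g _ hi
    have h2 := hmono j (max i j) (le_max_right _ _) g _ ha
    exact Option.some_injective _ (h1.symm.trans h2)
  refine ⟨x, fun j => (S j).1, strictMono_nat_of_lt_succ fun j => (hS j).lt, hxs, fun g => ?_,
    fun j => (S j).2, fun j => (hS j).holes_le, fun K => ?_⟩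
  · obtain ⟨j, hj⟩ := hx g
    exact ⟨j, by simp [hj]⟩
  · filter_upwards [hF K] with j hj c hc a
    obtain ⟨b, hb⟩ := (hS j).window c hc a
    exact ⟨b, fun g hg => hxs (j + 1) _ _ (hb g (hj hg))⟩

/-! ### Continuous pseudometrics on subshifts -/

namespace ContPseudometric

variable {X : Type*} [TopologicalSpace X] (ρ : ContPseudometric X)

theorem nonneg (x y : X) : 0 ≤ ρ.d x y := by
  have h := ρ.triangle x y x
  rw [ρ.self, ρ.symm y x] at h
  linarith

end ContPseudometric

section Subshift

variable {G : Type*} [Group G] {k : ℕ} {X : SubMulAction G (FullShift G k)}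

theorem smul_apply_shift (g h : G) (y : X) : (g • y).1 h = y.1 (g⁻¹ * h) := rfl

theorem continuous_smul_subshift (g : G) : Continuous fun y : X => g • y :=
  ((continuous_const_smul g).comp continuous_subtype_val).subtype_mk _

theorem isClosed_setOf_apply_eq (g : G) : IsClosed {p : X × X | p.1.1 g = p.2.1 g} :=
  isClosed_eq ((continuous_apply g).comp (continuous_subtype_val.comp continuous_fst))
    ((continuous_apply g).comp (continuous_subtype_val.comp continuous_snd))

theorem isOpen_setOf_apply_eq (g : G) : IsOpen {p : X × X | p.1.1 g = p.2.1 g} := by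
  have hc : Continuous fun p : X × X => (p.1.1 g, p.2.1 g) :=
    ((continuous_apply g).comp (continuous_subtype_val.comp continuous_fst)).prodMk
      ((continuous_apply g).comp (continuous_subtype_val.comp continuous_snd))
  exact (isOpen_discrete {q : Fin k × Fin k | q.1 = q.2}).preimage hc

/-- Points of a subshift which agree on a large finite set are close. -/
theorem exists_window_dist_lt [CompactSpace X] (ρ : ContPseudometric X) {ε : ℝ} (hε : 0 < ε) :
    ∃ K : Finset G, ∀ y z : X, (∀ g ∈ K, y.1 g = z.1 g) → ρ.d y z < ε := by
  have hcl : IsClosed {p : X × X | ε ≤ ρ.d p.1 p.2} := isClosed_le continuous_const ρ.cont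
  -- Pairs at distance at least `ε` form a compact set, and none of them agrees at every coordinate.
  obtain ⟨K, hK⟩ := hcl.isCompact.elim_finite_subfamily_closed
    (fun g : G => {p : X × X | p.1.1 g = p.2.1 g}) isClosed_setOf_apply_eq (by
      refine Set.eq_empty_of_forall_notMem fun p hp => ?_
      have he : p.1 = p.2 := Subtype.ext (funext fun g => Set.mem_iInter.1 hp.2 g)
      have h1 : ε ≤ ρ.d p.1 p.2 := hp.1
      rw [he, ρ.self] at h1
      linarith)
  refine ⟨K, fun y z h => ?_⟩
  by_contra! hd
  exact Set.eq_empty_iff_forall_notMem.1 hK (y, z) ⟨hd, Set.mem_iInter₂.2 h⟩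

/-- For a dynamically generating pseudometric on a subshift, finitely many translates detect the
value at the identity. -/
theorem exists_generating_window [CompactSpace X] (ρ : ContPseudometric X)
    (hρ : ρ.IsDynGenerating G) : ∃ (T : Finset G) (τ : ℝ), 0 < τ ∧
      ∀ y z : X, (∀ t ∈ T, ρ.d (t • y) (t • z) < τ) → y.1 1 = z.1 1 := by
  classical
  have hcl : IsClosed {p : X × X | p.1.1 1 = p.2.1 1}ᶜ := (isOpen_setOf_apply_eq 1).isClosed_compl
  -- The second index runs over thresholds `1 / (n + 1)`: on the compact set of pairs differing at
  -- the identity, finitely many conditions "translate by `t` brings the pair within the threshold"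
  -- are already incompatible. The smallest threshold then serves for all.
  obtain ⟨u, hu⟩ := hcl.isCompact.elim_finite_subfamily_closed
    (fun t : G × ℕ => {p : X × X | ρ.d (t.1 • p.1) (t.1 • p.2) ≤ 1 / ((t.2 : ℝ) + 1)})
    (fun t => isClosed_le (ρ.cont.comp
      (((continuous_smul_subshift t.1).comp continuous_fst).prodMk
        ((continuous_smul_subshift t.1).comp continuous_snd))) continuous_const) (by
      refine Set.eq_empty_of_forall_notMem fun p hp => ?_
      have hne : p.1 ≠ p.2 := fun he => hp.1 (by simp [he])
      obtain ⟨t, ht⟩ := hρ _ _ hne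
      obtain ⟨n, hn⟩ := exists_nat_one_div_lt ht
      exact absurd (Set.mem_iInter.1 hp.2 (t, n)) (not_le.2 hn))
  refine ⟨u.image Prod.fst, 1 / ((u.sup Prod.snd : ℕ) + 1), by positivity, fun y z h => ?_⟩
  by_contra hyz
  refine Set.eq_empty_iff_forall_notMem.1 hu (y, z) ⟨hyz, Set.mem_iInter₂.2 fun t ht => ?_⟩
  refine (h t.1 (Finset.mem_image_of_mem _ ht)).le.trans ?_
  have : t.2 ≤ u.sup Prod.snd := Finset.le_sup (f := Prod.snd) ht
  exact one_div_le_one_div_of_le (by positivity) (by gcongr)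

/-- There is a dynamically generating continuous pseudometric on every subshift. -/
theorem exists_isDynGenerating (X : SubMulAction G (FullShift G k)) :
    ∃ ρ : ContPseudometric X, ρ.IsDynGenerating G := by
  refine ⟨⟨fun y z => if y.1 1 = z.1 1 then 0 else 1, by simp, fun y z => by simp only [eq_comm],
    fun x y z => ?_, ?_⟩, fun y z hyz => ?_⟩
  · by_cases h1 : x.1 1 = y.1 1 <;> by_cases h2 : y.1 1 = z.1 1 <;> by_cases h3 : x.1 1 = z.1 1 <;>
      simp_all
  · exact continuous_const.if (fun p hp => by
      have hclop : IsClopen {p : X × X | p.1.1 1 = p.2.1 1} :=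
        ⟨isClosed_setOf_apply_eq 1, isOpen_setOf_apply_eq 1⟩
      rw [hclop.frontier_eq] at hp
      exact hp.elim) continuous_const
  · have hne : ∃ g, y.1 g ≠ z.1 g := by
      by_contra! h
      exact hyz (Subtype.ext (funext h))
    obtain ⟨g, hg⟩ := hne
    exact ⟨g⁻¹, by simp [smul_apply_shift, hg]⟩

end Subshift

/-! ### Mean and supremum distances between maps -/

section Approximation

variable {A : Type*} [Fintype A] {X : Type*} [TopologicalSpace X] (ρ : ContPseudometric X)

theorem dist2_le_of_forall_le {δ : ℝ} (hδ : 0 ≤ δ) {φ ψ : A → X} (h : ∀ v, ρ.d (φ v) (ψ v) ≤ δ) :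
    dist2 ρ.d φ ψ ≤ δ := by
  refine Real.sqrt_le_iff.2 ⟨hδ, div_le_of_le_mul₀ (by positivity) (by positivity) ?_⟩
  calc ∑ v, ρ.d (φ v) (ψ v) ^ 2 ≤ ∑ _v : A, δ ^ 2 :=
        Finset.sum_le_sum fun v _ => pow_le_pow_left₀ (ρ.nonneg _ _) (h v) 2
    _ = δ ^ 2 * Fintype.card A := by simp [mul_comm]

/-- Chebyshev's inequality. -/
theorem card_le_of_dist2_le {δ τ : ℝ} (hτ : 0 < τ) {φ ψ : A → X} (h : dist2 ρ.d φ ψ ≤ δ) :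
    ((Finset.univ.filter fun v => τ ≤ ρ.d (φ v) (ψ v)).card : ℝ) ≤
      (δ / τ) ^ 2 * Fintype.card A := by
  rcases isEmpty_or_nonempty A with hA | hA
  · simp
  have hpos : (0 : ℝ) < Fintype.card A := by exact_mod_cast Fintype.card_pos
  have h1 := (Real.sqrt_le_iff.1 h).2
  rw [div_le_iff₀ hpos] at h1
  rw [div_pow, div_mul_eq_mul_div, le_div_iff₀ (by positivity)]
  refine le_trans ?_ h1
  calc ((Finset.univ.filter fun v => τ ≤ ρ.d (φ v) (ψ v)).card : ℝ) * τ ^ 2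
      = ∑ v ∈ Finset.univ.filter fun v => τ ≤ ρ.d (φ v) (ψ v), τ ^ 2 := by simp
    _ ≤ ∑ v ∈ Finset.univ.filter fun v => τ ≤ ρ.d (φ v) (ψ v), ρ.d (φ v) (ψ v) ^ 2 :=
        Finset.sum_le_sum fun v hv => pow_le_pow_left₀ hτ.le (Finset.mem_filter.1 hv).2 2
    _ ≤ ∑ v, ρ.d (φ v) (ψ v) ^ 2 :=
        Finset.sum_le_sum_of_subset_of_nonneg (Finset.subset_univ _) fun _ _ _ => sq_nonneg _

theorem distSup_le {ε : ℝ} [Nonempty A] {φ ψ : A → X} (h : ∀ v, ρ.d (φ v) (ψ v) ≤ ε) :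
    distSup ρ.d φ ψ ≤ ε := ciSup_le h

theorem le_distSup {φ ψ : A → X} (v : A) : ρ.d (φ v) (ψ v) ≤ distSup ρ.d φ ψ :=
  le_ciSup (f := fun v => ρ.d (φ v) (ψ v)) (Set.finite_range _).bddAbove v

end Approximation

/-! ### Coherence of microstates along finite windows -/

/-- The right action of `G` on a group `A` through a homomorphism `q : G →* A`. -/
def rightPerm {G A : Type*} [Group G] [Group A] (q : G →* A) (g : G) : Equiv.Perm A :=
  Equiv.mulRight (q g)⁻¹

section Microstates

variable {G : Type*} [Group G] {k : ℕ} {X : SubMulAction G (FullShift G k)}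

/-- Good microstates are almost equivariant on a prescribed finite window. -/
theorem exists_mapSet_card_bad_le [CompactSpace X] (ρ : ContPseudometric X)
    (hρ : ρ.IsDynGenerating G) (K : Finset G) {η : ℝ} (hη : 0 < η) :
    ∃ (F : Finset G) (δ : ℝ), 0 < δ ∧ ∀ {A : Type*} [Group A] [Fintype A] (q : G →* A),
      ∀ φ ∈ mapSet ρ.d F δ (rightPerm q),
        (Nat.card {v // ∃ g ∈ K, (φ v).1 g ≠ (φ (v * q g)).1 1} : ℝ) ≤ η * Fintype.card A := by
  classical
  obtain ⟨T, τ, hτ, hT⟩ := exists_generating_window ρ hρ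
  let F : Finset G := T ∪ (K ×ˢ T).image fun p => p.2 * p.1⁻¹
  let N : ℝ := 2 * (K ×ˢ T).card + 1
  have hN : 0 < N := by positivity
  -- With this `δ`, Chebyshev at threshold `τ / 2` leaves a proportion at most `η / N` of bad
  -- vertices for each element of `F`. Each pair in `K ×ˢ T` uses two such bounds, and the extra one
  -- in `N` keeps it positive.
  refine ⟨F, τ / 2 * √(η / N), by positivity, fun {A} _ _ q φ hφ => ?_⟩
  let bad : G → Finset A := fun s =>
    Finset.univ.filter fun v => τ / 2 ≤ ρ.d (φ (rightPerm q s v)) (s • φ v)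
  have hbad : ∀ s ∈ F, ((bad s).card : ℝ) ≤ η / N * Fintype.card A := fun s hs => by
    have := card_le_of_dist2_le ρ (half_pos hτ) (hφ s hs)
    rwa [mul_div_cancel_left₀ _ (half_pos hτ).ne', Real.sq_sqrt (by positivity)] at this
  have hsub : (Finset.univ.filter fun v => ∃ g ∈ K, (φ v).1 g ≠ (φ (v * q g)).1 1) ⊆
      (K ×ˢ T).biUnion fun p => bad (p.2 * p.1⁻¹) ∪
        (bad p.2).image (fun u => u * (q p.1)⁻¹) := by
    intro v hv
    obtain ⟨g, hg, hne⟩ := (Finset.mem_filter.1 hv).2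
    by_contra hcon
    refine hne ?_
    have h1 : (φ v).1 g = (g⁻¹ • φ v).1 1 := by simp [smul_apply_shift]
    rw [h1]
    refine hT _ _ fun t ht => ?_
    have hcon' : v ∉ bad (t * g⁻¹) ∪ (bad t).image (fun u => u * (q g)⁻¹) := fun h =>
      hcon (Finset.mem_biUnion.2 ⟨(g, t), Finset.mem_product.2 ⟨hg, ht⟩, h⟩)
    rw [Finset.mem_union, not_or] at hcon'
    have h2 : ρ.d (φ (rightPerm q (t * g⁻¹) v)) ((t * g⁻¹) • φ v) < τ / 2 := by
      have := hcon'.1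
      simpa [bad] using this
    have h3 : ρ.d (φ (rightPerm q t (v * q g))) (t • φ (v * q g)) < τ / 2 := by
      by_contra! h
      exact hcon'.2 (Finset.mem_image.2 ⟨v * q g, by simpa [bad] using h, by simp⟩)
    -- Both sides are `v * q g * (q t)⁻¹`, so `t • g⁻¹ • φ v` and `t • φ (v * q g)` are each within
    -- `τ / 2` of the same point.
    have h4 : rightPerm q (t * g⁻¹) v = rightPerm q t (v * q g) := by
      simp [rightPerm, mul_assoc]
    rw [h4, mul_smul, ρ.symm] at h2
    linarith [ρ.triangle (t • g⁻¹ • φ v) (φ (rightPerm q t (v * q g))) (t • φ (v * q g))]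
  have hcard : ((Finset.univ.filter fun v => ∃ g ∈ K, (φ v).1 g ≠ (φ (v * q g)).1 1).card : ℝ) ≤
      ∑ p ∈ K ×ˢ T, (2 * (η / N * Fintype.card A)) := by
    calc _ ≤ ((∑ p ∈ K ×ˢ T, ((bad (p.2 * p.1⁻¹)).card + (bad p.2).card) : ℕ) : ℝ) := by
          refine Nat.cast_le.2 ((Finset.card_le_card hsub).trans (Finset.card_biUnion_le.trans
            (Finset.sum_le_sum fun p _ => (Finset.card_union_le (bad (p.2 * p.1⁻¹))
              ((bad p.2).image fun u => u * (q p.1)⁻¹)).trans ?_)))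
          exact Nat.add_le_add_left Finset.card_image_le _
      _ ≤ _ := by
          push_cast
          refine Finset.sum_le_sum fun p hp => ?_
          have h1 := hbad (p.2 * p.1⁻¹)
            (Finset.mem_union_right _ (Finset.mem_image.2 ⟨p, hp, rfl⟩))
          have h2 := hbad p.2 (Finset.mem_union_left _ (Finset.mem_product.1 hp).2)
          linarith
  rw [Nat.card_eq_fintype_card, Fintype.card_subtype]
  refine hcard.trans ?_
  rw [Finset.sum_const, nsmul_eq_mul]
  have : η * Fintype.card A - (K ×ˢ T).card * (2 * (η / N * Fintype.card A)) =
      η / N * Fintype.card A := by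
    field_simp
    simp only [N]
    ring
  have h0 : 0 ≤ η / N * Fintype.card A := by positivity
  linarith

end Microstates

/-! ### Logarithms of cardinalities -/

theorem log_div_le {m : ℕ∞} {M v : ℕ} {b : ℝ} (hv : 0 < v) (hm : m ≤ M)
    (hM : (M : ℝ) ≤ Real.exp (b * v)) :
    ENNReal.log (m : ENNReal) / ((v : ℝ) : EReal) ≤ (b : EReal) := by
  have hv' : (0 : EReal) < ((v : ℝ) : EReal) := by exact_mod_cast hv
  rw [EReal.div_le_iff_le_mul hv' (EReal.coe_ne_top _), ← EReal.coe_mul,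
    ← Real.log_exp ((v : ℝ) * b), ← ENNReal.log_ofReal_of_pos (Real.exp_pos _)]
  refine ENNReal.log_le_log ?_
  calc (m : ENNReal) ≤ ((M : ℕ∞) : ENNReal) := ENat.toENNReal_le.2 hm
    _ = ENNReal.ofReal (M : ℝ) := by simp
    _ ≤ _ := ENNReal.ofReal_le_ofReal (by rwa [mul_comm])

theorem le_log_div {m : ℕ∞} {M v : ℕ} {b : ℝ} (hv : 0 < v) (hm : (M : ℕ∞) ≤ m)
    (hM : Real.exp (b * v) ≤ M) :
    (b : EReal) ≤ ENNReal.log (m : ENNReal) / ((v : ℝ) : EReal) := by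
  have hv' : (0 : EReal) < ((v : ℝ) : EReal) := by exact_mod_cast hv
  rw [EReal.le_div_iff_mul_le hv' (EReal.coe_ne_top _), ← EReal.coe_mul,
    ← Real.log_exp (b * (v : ℝ)), ← ENNReal.log_ofReal_of_pos (Real.exp_pos _)]
  refine ENNReal.log_le_log ?_
  calc ENNReal.ofReal (Real.exp (b * v)) ≤ ENNReal.ofReal (M : ℝ) := ENNReal.ofReal_le_ofReal hM
    _ = ((M : ℕ∞) : ENNReal) := by simp
    _ ≤ _ := ENat.toENNReal_le.2 hm

/-- The number of functions with prescribed values off `U`. -/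
theorem card_piFinset_ite {A α : Type*} [Fintype A] [DecidableEq A] [Fintype α] (U : Finset A)
    (z : A → α) :
    (Fintype.piFinset fun u => if u ∈ U then Finset.univ else {z u}).card =
      Fintype.card α ^ U.card := by
  have h : ∀ u, (if u ∈ U then Finset.univ else {z u} : Finset α).card =
      if u ∈ U then Fintype.card α else 1 := fun u => by
    split_ifs <;> simp
  rw [Fintype.card_piFinset]
  simp_rw [h]
  rw [Finset.prod_ite_mem, Finset.univ_inter, Finset.prod_const]

/-- A set with `n` elements has at most `exp (η n)` subsets of small proportion. -/
theorem exists_card_small_subsets_le {η : ℝ} (hη : 0 < η) :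
    ∃ η' : ℝ, 0 < η' ∧ ∀ (A : Type*) [Fintype A] (D : ℕ), (D : ℝ) ≤ η' * Fintype.card A →
      ((Finset.univ.filter fun B : Finset A => B.card ≤ D).card : ℝ) ≤
        Real.exp (η * Fintype.card A) := by
  classical
  -- Exponential weighting: each counted subset has weight at least `t ^ D`, while all subsets
  -- together weigh `(1 + t) ^ n`. The cap at one makes powers of `t` decrease.
  set t : ℝ := min 1 (η / 2) with ht
  have ht0 : 0 < t := lt_min one_pos (half_pos hη)
  have ht1 : t ≤ 1 := min_le_left _ _
  have hlog : 0 ≤ -Real.log t := by linarith [Real.log_nonpos ht0.le ht1]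
  refine ⟨η / 2 / (-Real.log t + 1), by positivity, fun A _ D hD => ?_⟩
  have h1 : ((Finset.univ.filter fun B : Finset A => B.card ≤ D).card : ℝ) * t ^ D ≤
      (t + 1) ^ Fintype.card A := by
    calc _ = ∑ B : Finset A with B.card ≤ D, t ^ D := by simp
      _ ≤ ∑ B : Finset A with B.card ≤ D, t ^ B.card :=
          Finset.sum_le_sum fun B hB =>
            pow_le_pow_of_le_one ht0.le ht1 (Finset.mem_filter.1 hB).2
      _ ≤ ∑ B : Finset A, t ^ B.card :=
          Finset.sum_le_sum_of_subset_of_nonneg (Finset.subset_univ _) fun _ _ _ => by positivity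
      _ = _ := by
          have := Finset.sum_pow_mul_eq_add_pow t 1 (Finset.univ : Finset A)
          simpa using this
  have h2 : (t + 1) ^ Fintype.card A ≤ Real.exp (t * Fintype.card A) := by
    rw [mul_comm, Real.exp_nat_mul]
    exact pow_le_pow_left₀ (by positivity) (Real.add_one_le_exp t) _
  have h3 : t ^ D = Real.exp (D * Real.log t) := by rw [Real.exp_nat_mul, Real.exp_log ht0]
  rw [h3] at h1
  have h4 := h1.trans h2
  rw [← le_div_iff₀ (Real.exp_pos _), ← Real.exp_sub] at h4
  refine h4.trans (Real.exp_le_exp.2 ?_)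
  have h5 : t * Fintype.card A ≤ η / 2 * Fintype.card A := by
    gcongr
    exact min_le_right _ _
  have h6 : D * (-Real.log t + 1) ≤ η / 2 * Fintype.card A := by
    rw [div_mul_eq_mul_div, le_div_iff₀ (by positivity)] at hD
    exact hD
  nlinarith [Nat.cast_nonneg (α := ℝ) D]

/-! ### Lower bound -/

section Lower

variable {G : Type*} [Group G] {k : ℕ} {X : SubMulAction G (FullShift G k)}

/-- Colourings of a finite group all of whose windows occur in a subshift give rise to a separated
set of microstates. -/
theorem exists_card_le_sepNumber [CompactSpace X] (ρ : ContPseudometric X)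
    (hρ : ρ.IsDynGenerating G) :
    ∃ ε : ℝ, 0 < ε ∧ ∀ (F : Finset G) (δ : ℝ), 0 < δ → ∃ K : Finset G,
      ∀ {A : Type*} [Group A] [Fintype A] (q : G →* A) (C : Finset (A → Fin k)),
        (∀ c ∈ C, ∀ v, ∃ y : X, ∀ g ∈ K, y.1 g = c (v * q g)) →
        (C.card : ℕ∞) ≤ sepNumber ε (mapSet ρ.d F δ (rightPerm q)) (distSup ρ.d) := by
  classical
  obtain ⟨T, τ, hτ, hT⟩ := exists_generating_window ρ hρ
  refine ⟨τ / 2, half_pos hτ, fun F δ hδ => ?_⟩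
  obtain ⟨K, hK⟩ := exists_window_dist_lt ρ (lt_min hδ (by positivity : 0 < τ / 4))
  -- The window must show the colour at the identity, the coordinates in `K`, and their shifts by
  -- elements of `F` (for almost equivariance) and of `T` (for separation).
  refine ⟨{1} ∪ K ∪ ((F ∪ T) ×ˢ K).image fun p => p.1⁻¹ * p.2, fun {A} _ _ q C hC => ?_⟩
  choose φ hφ using fun (c : C) => hC c.1 c.2
  have h1 : ∀ c v, (φ c v).1 1 = c.1 v := fun c v => by
    simpa using hφ c v 1 (by simp)
  have hgood : ∀ c, ∀ s ∈ F ∪ T, ∀ v,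
      ρ.d (φ c (rightPerm q s v)) (s • φ c v) < min δ (τ / 4) := fun c s hs v => by
    refine hK _ _ fun g hg => ?_
    rw [hφ c _ g (by simp [hg]), smul_apply_shift, hφ c v (s⁻¹ * g)
      (Finset.mem_union_right _ (Finset.mem_image.2 ⟨(s, g), by simp [hg, Finset.mem_union.1 hs]⟩))]
    simp [rightPerm, mul_assoc]
  have hinj : Function.Injective φ := fun c c' h => by
    refine Subtype.ext (funext fun v => ?_)
    rw [← h1 c v, ← h1 c' v, h]
  have hcard : (C.card : ℕ∞) ≤ (Set.range φ).encard := by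
    simpa [ENat.card_eq_coe_fintype_card] using hinj.encard_range
  refine le_iSup₂_of_le (Set.range φ) ⟨?_, ?_⟩ hcard
  · rintro _ ⟨c, rfl⟩ s hs
    exact dist2_le_of_forall_le ρ hδ.le fun v =>
      (hgood c s (Finset.mem_union_left _ hs) v).le.trans (min_le_left _ _)
  · rintro _ ⟨c, rfl⟩ _ ⟨c', rfl⟩ hne
    have hv : ∃ v, c.1 v ≠ c'.1 v := by
      by_contra! h
      exact hne (congrArg φ (Subtype.ext (funext h)))
    obtain ⟨v, hv⟩ := hv
    rw [← h1 c v, ← h1 c' v] at hv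
    have ht : ∃ t ∈ T, τ ≤ ρ.d (t • φ c v) (t • φ c' v) := by
      by_contra! h
      exact hv (hT _ _ h)
    obtain ⟨t, htT, ht⟩ := ht
    have h2 := (hgood c t (Finset.mem_union_right _ htT) v).trans_le (min_le_right _ _)
    have h3 := (hgood c' t (Finset.mem_union_right _ htT) v).trans_le (min_le_right _ _)
    have h4 := le_distSup ρ (φ := φ c) (ψ := φ c') (rightPerm q t v)
    rw [ρ.symm] at h2
    -- A separation of `τ` loses two errors, each below `τ / 4`, leaving more than `τ / 2`.
    linarith [ρ.triangle (t • φ c v) (φ c (rightPerm q t v)) (t • φ c' v),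
      ρ.triangle (φ c (rightPerm q t v)) (φ c' (rightPerm q t v)) (t • φ c' v)]

end Lower

/-! ### Upper bound -/

section Upper

variable {G : Type*} [Group G] {k : ℕ} {X : SubMulAction G (FullShift G k)}

/-- If every point of a subshift extends a translate of a periodic partial configuration `p`, then
microstates on a finite group `A` are determined, up to a small error, by their colours at the holes
of translates of `p`, one translate for each member of a sparse subset of `A`. -/
theorem sepNumber_le [Nonempty (Fin k)] (ρ : ContPseudometric X) {ε : ℝ} {K₀ K L : Finset G}
    (hK₀ : ∀ y z : X, (∀ g ∈ K₀, y.1 g = z.1 g) → ρ.d y z < ε)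
    {A Q : Type*} [Group A] [Group Q] [Fintype A] [Fintype Q] (q : G →* A) (π : A →* Q)
    (p : Q → Option (Fin k))
    (hX : ∀ y : X, ∃ a : Q, ∀ g i, p (a * π (q g)) = some i → y.1 g = i)
    (r : Q → G) (hr : ∀ a, π (q (r a)) = a) (hL : L.Nonempty) (hLker : ∀ l ∈ L, π (q l) = 1)
    (hLinj : Set.InjOn q L) (hK₀K : K₀ ⊆ K)
    (hLK : ∀ l ∈ L, ∀ l' ∈ L, ∀ a, l * l'⁻¹ * r a ∈ K) (Y : Set (A → X)) (D : ℕ)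
    (hY : ∀ φ ∈ Y, Nat.card {v // ∃ g ∈ K, (φ v).1 g ≠ (φ (v * q g)).1 1} ≤ D) :
    ∃ w : ℕ, w * L.card ≤ Nat.card π.ker ∧ sepNumber ε Y (distSup ρ.d) ≤
      (((Finset.univ.filter fun B : Finset A => B.card ≤ D).card * Fintype.card Q ^ w *
        (k ^ (Fintype.card Q * L.card ^ 2 * D + Nat.card π.ker * Nat.card {a // p a = none}) *
          (k ^ K₀.card) ^ D) : ℕ) : ℕ∞) := by
  classical
  let kerF : Finset A := Finset.univ.filter fun u => π u = 1
  have hker : Nat.card π.ker = kerF.card := by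
    rw [← Fintype.card_subtype, ← Nat.card_eq_fintype_card]
    rfl
  have hLA : (L.image q).card = L.card := Finset.card_image_of_injOn hLinj
  have hLpos : 0 < L.card := hL.card_pos
  -- Ruzsa covering, inside the kernel: `kerF * L` does not leave the kernel, so at most `|ker π| /
  -- |L|` translates of `L / L` cover it. A large `L` makes the centres `W` sparse.
  obtain ⟨W, hWker, hWcard, hcover⟩ := Finset.ruzsa_covering_mul (A := kerF) (B := L.image q)
    (K := kerF.card / L.card) (hL.image q) (by
      rw [hLA, div_mul_cancel₀ _ (by positivity)]
      refine Nat.cast_le.2 (Finset.card_le_card fun u hu => ?_)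
      obtain ⟨a, ha, b, hb, rfl⟩ := Finset.mem_mul.1 hu
      obtain ⟨l, hl, rfl⟩ := Finset.mem_image.1 hb
      have ha' : π a = 1 := by simpa [kerF] using ha
      simp [kerF, ha', hLker l hl])
  have hW : W.card * L.card ≤ kerF.card := by
    rw [le_div_iff₀ (by positivity)] at hWcard
    exact_mod_cast hWcard
  have hcov : ∀ u : A, ∃ w l l', u ∈ kerF → w ∈ W ∧ l ∈ L ∧ l' ∈ L ∧ u = w * q (l * l'⁻¹) := by
    intro u
    by_cases hu : u ∈ kerF
    · obtain ⟨w, hw, d, hd, rfl⟩ := Finset.mem_mul.1 (hcover hu)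
      obtain ⟨a, ha, b, hb, rfl⟩ := Finset.mem_div.1 hd
      obtain ⟨l, hl, rfl⟩ := Finset.mem_image.1 ha
      obtain ⟨l', hl', rfl⟩ := Finset.mem_image.1 hb
      exact ⟨w, l, l', fun _ => ⟨hw, hl, hl', by simp [div_eq_mul_inv]⟩⟩
    -- Dummy values, never used: the choice is only applied to `b u`, which lies in the kernel.
    · exact ⟨1, 1, 1, fun h => absurd h hu⟩
  choose w₀ l₀ l₁ hw₀ using hcov
  let b : A → A := fun u => u * (q (r (π u)))⁻¹
  have hb : ∀ u, b u ∈ kerF := fun u => by simp [b, kerF, hr]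
  let w : A → A := fun u => w₀ (b u)
  -- Every `u` is reached from its centre as `w u * q (γ u)` with `γ u ∈ K`, so a good centre sees
  -- the colour at `u`.
  let γ : A → G := fun u => l₀ (b u) * (l₁ (b u))⁻¹ * r (π u)
  have hwW : ∀ u, w u ∈ W := fun u => (hw₀ _ (hb u)).1
  have hγK : ∀ u, γ u ∈ K := fun u =>
    hLK _ (hw₀ _ (hb u)).2.1 _ (hw₀ _ (hb u)).2.2.1 _
  have hwγ : ∀ u, w u * q (γ u) = u := fun u => by
    have := (hw₀ _ (hb u)).2.2.2
    simp only [w, γ]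
    rw [map_mul, ← mul_assoc, ← this]
    simp [b]
  have hπγ : ∀ u, π (q (γ u)) = π u := fun u => by
    have h := congrArg π (hwγ u)
    have hw1 : π (w u) = 1 := by simpa [kerF] using hWker (hwW u)
    rwa [map_mul, hw1, one_mul] at h
  choose pos hpos using hX
  let z : Fin k := Classical.arbitrary _
  -- The vertices whose colour is not predicted: either the centre is bad, or the recorded translate
  -- of `p` has a hole there.
  let U : Finset A × (A → Q) → Finset A := fun t =>
    Finset.univ.filter fun u => w u ∈ t.1 ∨ p (t.2 (w u) * π u) = none
  let bad : (A → X) → Finset A := fun φ =>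
    Finset.univ.filter fun v => ∃ g ∈ K, (φ v).1 g ≠ (φ (v * q g)).1 1
  let ctr : (A → X) → A → Q := fun φ v => if v ∈ W then pos (φ v) else 1
  -- The code records the bad set, the translates at the centres, the unpredicted colours, and the
  -- full `K₀`-windows at bad vertices. Fixed default values elsewhere keep the number of codes
  -- small.
  let code : (A → X) → (Finset A × (A → Q)) × (A → Fin k) × (A → K₀ → Fin k) := fun φ =>
    ((bad φ, ctr φ), (fun u => if u ∈ U (bad φ, ctr φ) then (φ u).1 1 else z),
      fun v => if v ∈ bad φ then fun g => (φ v).1 g else fun _ => z)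
  let Bs : Finset (Finset A) := Finset.univ.filter fun B => B.card ≤ D
  let As : Finset (A → Q) := Fintype.piFinset fun v => if v ∈ W then Finset.univ else {1}
  let codes : Finset ((Finset A × (A → Q)) × (A → Fin k) × (A → K₀ → Fin k)) :=
    (Bs ×ˢ As).biUnion fun t => {t} ×ˢ
      ((Fintype.piFinset fun u => if u ∈ U t then Finset.univ else {z}) ×ˢ
        (Fintype.piFinset fun v => if v ∈ t.1 then Finset.univ else {fun _ => z}))
  have hbadD : ∀ φ ∈ Y, (bad φ).card ≤ D := fun φ hφ => by
    have := hY φ hφ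
    rwa [Nat.card_eq_fintype_card, Fintype.card_subtype] at this
  have hgood : ∀ φ v, v ∉ bad φ → ∀ g ∈ K, (φ v).1 g = (φ (v * q g)).1 1 := by
    intro φ v hv g hg
    by_contra hne
    exact hv (Finset.mem_filter.2 ⟨Finset.mem_univ _, g, hg, hne⟩)
  have hcode : ∀ φ ∈ Y, code φ ∈ codes := fun φ hφ => by
    refine Finset.mem_biUnion.2 ⟨(bad φ, ctr φ), Finset.mem_product.2 ⟨?_, ?_⟩,
      Finset.mem_product.2 ⟨Finset.mem_singleton_self _, Finset.mem_product.2 ⟨?_, ?_⟩⟩⟩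
    · exact Finset.mem_filter.2 ⟨Finset.mem_univ _, hbadD φ hφ⟩
    · refine Fintype.mem_piFinset.2 fun v => ?_
      by_cases hv : v ∈ W <;> simp [ctr, hv]
    · refine Fintype.mem_piFinset.2 fun v => ?_
      by_cases hv : v ∈ U (bad φ, ctr φ) <;> simp [code, hv]
    · refine Fintype.mem_piFinset.2 fun v => ?_
      by_cases hv : v ∈ bad φ <;> simp [code, hv]
  have hdet : ∀ φ ψ, code φ = code ψ → ∀ v, ρ.d (φ v) (ψ v) < ε := by
    intro φ ψ he v
    have hB : bad φ = bad ψ := congrArg (fun c => c.1.1) he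
    have ha : ctr φ = ctr ψ := congrArg (fun c => c.1.2) he
    have hcol : ∀ u, (φ u).1 1 = (ψ u).1 1 := fun u => by
      by_cases hu : u ∈ U (bad φ, ctr φ)
      · have h := congrFun (congrArg (fun c => c.2.1) he) u
        have hu' : u ∈ U (bad ψ, ctr ψ) := by rwa [← hB, ← ha]
        simpa only [code, if_pos hu, if_pos hu'] using h
      · have hu' : w u ∉ bad φ ∧ p (ctr φ (w u) * π u) ≠ none := by
          simpa [U, not_or] using hu
        obtain ⟨i, hi⟩ := Option.ne_none_iff_exists'.1 hu'.2
        have hval : ∀ χ : A → X, bad χ = bad φ → ctr χ = ctr φ → (χ u).1 1 = i := by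
          intro χ h1 h2
          have h3 := hgood χ (w u) (h1 ▸ hu'.1) (γ u) (hγK u)
          rw [hwγ] at h3
          rw [← h3]
          refine hpos (χ (w u)) (γ u) i ?_
          rw [hπγ, ← hi, ← h2]
          simp [ctr, hwW u]
        rw [hval φ rfl rfl, hval ψ hB.symm ha.symm]
    refine hK₀ _ _ fun g hg => ?_
    by_cases hv : v ∈ bad φ
    · have h := congrFun (congrFun (congrArg (fun c => c.2.2) he) v) ⟨g, hg⟩
      have hv' : v ∈ bad ψ := hB ▸ hv
      simpa only [code, if_pos hv, if_pos hv'] using h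
    · rw [hgood φ v hv g (hK₀K hg), hgood ψ v (hB ▸ hv) g (hK₀K hg), hcol]
  have hUcard : ∀ t : Finset A × (A → Q), t.1.card ≤ D →
      (U t).card ≤ Fintype.card Q * L.card ^ 2 * D +
        Nat.card π.ker * Nat.card {a // p a = none} := by
    intro t ht
    have h1 : (Finset.univ.filter fun u => w u ∈ t.1).card ≤ (t.1 ×ˢ (L ×ˢ (L ×ˢ Finset.univ :
        Finset (G × Q)))).card := by
      refine Finset.card_le_card_of_injOn (fun u => (w u, l₀ (b u), l₁ (b u), π u)) ?_ ?_
      · intro u hu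
        have hu' : w u ∈ t.1 := by simpa using hu
        simp [hu', (hw₀ _ (hb u)).2.1, (hw₀ _ (hb u)).2.2.1]
      · intro u _ u' _ he
        simp only [Prod.mk.injEq] at he
        obtain ⟨e1, e2, e3, e4⟩ := he
        rw [← hwγ u, ← hwγ u', e1]
        simp only [γ, e2, e3, e4]
    -- The kernel part `b u` fixes the centre, hence the translate; then `π u` can take only as many
    -- values as `p` has holes.
    have h2 : (Finset.univ.filter fun u => p (t.2 (w u) * π u) = none).card ≤
        (kerF ×ˢ (Finset.univ.filter fun a => p a = none)).card := by
      refine Finset.card_le_card_of_injOn (fun u => (b u, t.2 (w u) * π u)) ?_ ?_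
      · intro u hu
        have hu' : p (t.2 (w u) * π u) = none := by simpa using hu
        simp [hu', hb u]
      · intro u _ u' _ he
        simp only [Prod.mk.injEq] at he
        obtain ⟨e1, e2⟩ := he
        have hww : w u = w u' := congrArg w₀ e1
        rw [hww, mul_right_inj] at e2
        have h3 : u = b u * q (r (π u)) := by simp [b]
        rw [h3, e1, e2]
        simp [b]
    have h3 : Nat.card {a // p a = none} = (Finset.univ.filter fun a => p a = none).card := by
      rw [Nat.card_eq_fintype_card, Fintype.card_subtype]
    have h4 : (U t).card ≤ (Finset.univ.filter fun u => w u ∈ t.1).card +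
        (Finset.univ.filter fun u => p (t.2 (w u) * π u) = none).card := by
      simp only [U, Finset.filter_or]
      exact Finset.card_union_le _ _
    rw [hker, h3]
    refine h4.trans (add_le_add (h1.trans ?_) (h2.trans (Finset.card_product _ _).le))
    simp only [Finset.card_product, Finset.card_univ]
    calc t.1.card * (L.card * (L.card * Fintype.card Q))
        = Fintype.card Q * L.card ^ 2 * t.1.card := by ring
      _ ≤ _ := Nat.mul_le_mul_left _ ht
  have hk : 0 < k := Fin.pos z
  have hcodes : codes.card ≤ Bs.card * Fintype.card Q ^ W.card *
      (k ^ (Fintype.card Q * L.card ^ 2 * D + Nat.card π.ker * Nat.card {a // p a = none}) *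
          (k ^ K₀.card) ^ D) := by
    refine (Finset.card_biUnion_le_card_mul (Bs ×ˢ As) _
      (k ^ (Fintype.card Q * L.card ^ 2 * D + Nat.card π.ker * Nat.card {a // p a = none}) *
        (k ^ K₀.card) ^ D) fun t ht => ?_).trans_eq ?_
    · have htD : t.1.card ≤ D := (Finset.mem_filter.1 (Finset.mem_product.1 ht).1).2
      rw [Finset.card_product, Finset.card_singleton, one_mul, Finset.card_product,
        card_piFinset_ite, card_piFinset_ite]
      simp only [Fintype.card_fin, Fintype.card_fun, Fintype.card_coe]
      exact Nat.mul_le_mul (Nat.pow_le_pow_right hk (hUcard t htD))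
        (Nat.pow_le_pow_right (by positivity) htD)
    · rw [Finset.card_product, card_piFinset_ite]
  refine ⟨W.card, hker ▸ hW, iSup₂_le fun E hE => ?_⟩
  refine le_trans ?_ (Nat.cast_le.2 hcodes)
  rw [← Set.encard_coe_eq_coe_finsetCard]
  refine Set.encard_le_encard_of_injOn (f := code) (fun φ hφ => hcode φ (hE.1 hφ)) ?_
  intro φ hφ ψ hψ he
  by_contra hne
  exact absurd (distSup_le ρ fun v => (hdet φ ψ he v).le) (not_le.2 (hE.2 φ hφ ψ hψ hne))

end Upper

/-! ### Entropy of orbit closures along the coset approximation -/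

section Toeplitz

variable {G : Type*} [Group G] {H : ℕ → Subgroup G} {k : ℕ}

instance (x : FullShift G k) : CompactSpace (orbitClosure x) :=
  isCompact_iff_compactSpace.1 (isClosed_closure (s := MulAction.orbit G x)).isCompact

/-- Every point in the orbit closure of an extension of a partial configuration `s` extends a
translate of `s`. -/
theorem exists_translate_of_mem_orbitClosure [∀ n, (H n).Normal] [∀ n, (H n).FiniteIndex]
    {x : FullShift G k} (s : PartialConfig H k)
    (hx : ∀ (g : G) a, s.p g = some a → x g = a) (y : orbitClosure x) :
    ∃ a : G ⧸ H s.n, ∀ (g : G) i, s.p (a * (g : G ⧸ H s.n)) = some i → y.1 g = i := by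
  let Z : G ⧸ H s.n → Set (FullShift G k) := fun a =>
    {y | ∀ (g : G) i, s.p (a * (g : G ⧸ H s.n)) = some i → y g = i}
  have hZ : ∀ a, IsClosed (Z a) := fun a => by
    simp only [Z, Set.ofPred_forall]
    exact isClosed_iInter fun g => isClosed_iInter fun i => isClosed_iInter fun _ =>
      isClosed_eq (continuous_apply g) continuous_const
  have hsub : closure (MulAction.orbit G x) ⊆ ⋃ a, Z a := by
    -- There are only finitely many translates, so the union of these closed sets is closed; it
    -- suffices to treat the orbit.
    refine closure_minimal ?_ (isClosed_iUnion_of_finite hZ)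
    rintro _ ⟨b, rfl⟩
    refine Set.mem_iUnion.2 ⟨((b⁻¹ : G) : G ⧸ H s.n), fun g i hi => ?_⟩
    exact hx (b⁻¹ * g) i hi
  exact Set.mem_iUnion.1 (hsub y.2)

variable (hnormal : ∀ n, (H n).Normal) (hindex : ∀ n, (H n).FiniteIndex)
    (hanti : Antitone H) (hinf : ⨅ n, H n = ⊥)
include hnormal hindex hanti hinf

/-- The sofic entropy of the orbit closure of an extension of a partial configuration is bounded
in terms of its proportion of holes. -/
theorem entropyOf_le_holes [Infinite G] (hk : 2 ≤ k) {x : FullShift G k} (s : PartialConfig H k)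
    (hx : ∀ (g : G) a, s.p g = some a → x g = a) (ρ : ContPseudometric (orbitClosure x))
    (hρ : ρ.IsDynGenerating G) :
    entropyOf (cosetApproximation H hnormal hindex hanti hinf) ρ ≤
      (((s.holes : ℝ) / s.size * Real.log k : ℝ) : EReal) := by
  classical
  have : Nonempty (Fin k) := ⟨⟨0, by omega⟩⟩
  refine iSup₂_le fun ε hε => EReal.le_of_forall_lt_iff_le.1 fun z hz => ?_
  have hz' := EReal.coe_lt_coe_iff.1 hz
  -- One third of the slack each for the choice of bad set, the translates at the centres, and the
  -- additional colours caused by bad vertices.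
  obtain ⟨η, hη⟩ : ∃ η, η = (z - (s.holes : ℝ) / s.size * Real.log k) / 3 := ⟨_, rfl⟩
  have hη0 : 0 < η := by rw [hη]; linarith
  have := Fintype.ofFinite (G ⧸ H s.n)
  have hsizeF : s.size = Fintype.card (G ⧸ H s.n) := Nat.card_eq_fintype_card
  have hsize : (0 : ℝ) < s.size := by exact_mod_cast Nat.card_pos
  have hlogk : 0 ≤ Real.log k := Real.log_natCast_nonneg k
  obtain ⟨K₀, hK₀⟩ := exists_window_dist_lt ρ hε
  -- With `|L| ≥ ℓ`, recording an element of `G ⧸ H s.n` at each of at most `|ker π| / |L|` centres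
  -- costs at most `η * |ker π|`.
  obtain ⟨ℓ, hℓ⟩ := exists_nat_ge (Real.log s.size / η)
  have hH := infinite_of_finiteIndex (H s.n)
  obtain ⟨L, hLH, hLcard⟩ := (Set.infinite_coe_iff.1 hH).exists_subset_card_eq (ℓ + 1)
  have hL : L.Nonempty := Finset.card_pos.1 (by omega)
  let K : Finset G := K₀ ∪ (L ×ˢ (L ×ˢ (Finset.univ : Finset (G ⧸ H s.n)))).image fun t =>
    t.1 * t.2.1⁻¹ * t.2.2.out
  obtain ⟨η₁, hη₁, hsub⟩ := exists_card_small_subsets_le hη0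
  let C : ℝ := ((s.size : ℝ) * L.card ^ 2 + K₀.card) * Real.log k
  have hC : 0 ≤ C := by positivity
  let η₂ : ℝ := min η₁ (η / (C + 1))
  have hη₂ : 0 < η₂ := lt_min hη₁ (by positivity)
  obtain ⟨F, δ, hδ, hbad⟩ := exists_mapSet_card_bad_le ρ hρ K hη₂
  refine iInf_le_of_le F (iInf₂_le_of_le δ hδ (limsup_le_of_le (by isBoundedDefault) ?_))
  filter_upwards [eventually_ge_atTop s.n, eventually_injOn_mk hanti hinf L] with n hn hinj
  let _ : Fintype (G ⧸ H n) := Fintype.ofFinite (G ⧸ H n)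
  let q : G →* G ⧸ H n := QuotientGroup.mk' (H n)
  let π : G ⧸ H n →* G ⧸ H s.n := QuotientGroup.map _ _ (MonoidHom.id G) (hanti hn)
  let v := Fintype.card (G ⧸ H n)
  have hv : 0 < v := Fintype.card_pos
  obtain ⟨D, hDle, hDge⟩ : ∃ D : ℕ, (D : ℝ) ≤ η₂ * v ∧ ∀ m : ℕ, (m : ℝ) ≤ η₂ * v → m ≤ D :=
    ⟨⌊η₂ * v⌋₊, Nat.floor_le (by positivity), fun m hm => Nat.le_floor hm⟩
  have hπ : Function.Surjective π := fun a => by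
    obtain ⟨g, rfl⟩ := QuotientGroup.mk_surjective a
    exact ⟨g, rfl⟩
  obtain ⟨w, hw, hsep⟩ := sepNumber_le ρ hK₀ q π s.p
    (exists_translate_of_mem_orbitClosure s hx) Quotient.out (fun a => Quotient.out_eq' a) hL
    (fun l hl => (QuotientGroup.eq_one_iff l).2 (hLH hl)) hinj Finset.subset_union_left
    (K := K) (fun l hl l' hl' a => Finset.mem_union_right _
      (Finset.mem_image.2 ⟨(l, l', a), by simp [hl, hl'], rfl⟩))
    (mapSet ρ.d F δ (rightPerm q)) D (fun φ hφ => hDge _ (hbad q φ hφ))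
  have hvker : v = s.size * Nat.card π.ker := by
    have := card_eq_card_mul_card_ker π hπ
    rwa [Nat.card_eq_fintype_card] at this
  have hmain : ENNReal.log ((sepNumber ε (mapSet ρ.d F δ (rightPerm q)) (distSup ρ.d) : ℕ∞) :
      ENNReal) / ((v : ℝ) : EReal) ≤ (z : EReal) := by
    refine log_div_le hv hsep ?_
    have hvker' : (v : ℝ) = s.size * Nat.card π.ker := by exact_mod_cast hvker
    have hkerv : (Nat.card π.ker : ℝ) ≤ v := by
      exact_mod_cast hvker ▸ Nat.le_mul_of_pos_left _ (by exact_mod_cast hsize)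
    have hk0 : (0 : ℝ) < k := by positivity
    have hpow : ∀ m : ℕ, (k : ℝ) ^ m = Real.exp (m * Real.log k) := fun m => by
      rw [Real.exp_nat_mul, Real.exp_log hk0]
    have hB : ((Finset.univ.filter fun B : Finset (G ⧸ H n) => B.card ≤ D).card : ℝ) ≤
        Real.exp (η * v) :=
      hsub _ D (hDle.trans (mul_le_mul_of_nonneg_right (min_le_left _ _) (by positivity)))
    have hNw : (s.size : ℝ) ^ w ≤ Real.exp (η * v) := by
      rw [← Real.exp_log hsize, ← Real.exp_nat_mul]
      refine Real.exp_le_exp.2 ?_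
      rw [div_le_iff₀ hη0] at hℓ
      have hw' : (w : ℝ) * L.card ≤ Nat.card π.ker := by exact_mod_cast hw
      have hL' : (ℓ : ℝ) ≤ L.card := by exact_mod_cast (by omega : ℓ ≤ L.card)
      calc (w : ℝ) * Real.log s.size ≤ w * (L.card * η) := by gcongr; exact hℓ.trans (by gcongr)
        _ = η * (w * L.card) := by ring
        _ ≤ η * v := by gcongr; exact hw'.trans hkerv
    have hCD : C * D ≤ η * v := by
      have h1 : (D : ℝ) ≤ η / (C + 1) * v :=
        hDle.trans (mul_le_mul_of_nonneg_right (min_le_right _ _) (by positivity))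
      rw [div_mul_eq_mul_div, le_div_iff₀ (by positivity)] at h1
      linarith [Nat.cast_nonneg (α := ℝ) D]
    have hcol : (k : ℝ) ^ (s.size * L.card ^ 2 * D + Nat.card π.ker * s.holes) *
        ((k : ℝ) ^ K₀.card) ^ D ≤
        Real.exp (η * v + (s.holes : ℝ) / s.size * Real.log k * v) := by
      rw [← pow_mul, ← pow_add, hpow]
      refine Real.exp_le_exp.2 ?_
      have h2 : (s.holes : ℝ) / s.size * Real.log k * v =
          Nat.card π.ker * s.holes * Real.log k := by
        rw [hvker']
        field_simp
      rw [h2]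
      push_cast
      linarith
    push_cast
    rw [← hsizeF]
    calc _ ≤ Real.exp (η * v) * Real.exp (η * v) *
          Real.exp (η * v + (s.holes : ℝ) / s.size * Real.log k * v) := by
          refine mul_le_mul (mul_le_mul hB hNw (by positivity) (by positivity)) hcol
            (by positivity) (by positivity)
      _ = Real.exp (z * v) := by
          rw [← Real.exp_add, ← Real.exp_add]
          congr 1
          rw [eq_div_iff three_ne_zero] at hη
          linear_combination (v : ℝ) * hη
  exact hmain

/-- If all translates of all fillings of infinitely many partial configurations occur in `x`, then
the sofic entropy of the orbit closure of `x` is at least the proportion of holes. -/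
theorem le_entropyOf_of_fillings (hk : 2 ≤ k) {x : FullShift G k} {κ : ℝ}
    (s : ℕ → PartialConfig H k) (hs : StrictMono fun j => (s j).n)
    (hholes : ∀ j, κ * (s j).size < (s j).holes)
    (hwindow : ∀ K : Finset G, ∀ᶠ j in atTop, ∀ c, (s j).IsFilling c → ∀ a : G, ∃ b : G,
        ∀ g ∈ K, x (b * g) = c ((a * g : G) : G ⧸ H (s j).n))
    (ρ : ContPseudometric (orbitClosure x)) (hρ : ρ.IsDynGenerating G) :
    ((κ * Real.log k : ℝ) : EReal) ≤
      entropyOf (cosetApproximation H hnormal hindex hanti hinf) ρ := by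
  classical
  have hz : Nonempty (Fin k) := ⟨⟨0, by omega⟩⟩
  obtain ⟨z⟩ := hz
  obtain ⟨ε, hε, h⟩ := exists_card_le_sepNumber ρ hρ
  refine le_iSup₂_of_le ε hε (le_iInf fun F => le_iInf₂ fun δ hδ => ?_)
  obtain ⟨K, hK⟩ := h F δ hδ
  -- A limsup is bounded below along the subsequence of levels `(s j).n`.
  refine le_limsup_of_frequently_le (hs.tendsto_atTop.frequently
    ((hwindow K).mono fun j hj => ?_).frequently) (by isBoundedDefault)
  let _ : Fintype (G ⧸ H (s j).n) := Fintype.ofFinite (G ⧸ H (s j).n)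
  let U : Finset (G ⧸ H (s j).n) := Finset.univ.filter fun u => (s j).p u = none
  let C : Finset (G ⧸ H (s j).n → Fin k) :=
    Fintype.piFinset fun u => if u ∈ U then Finset.univ else {((s j).p u).getD z}
  have hU : U.card = (s j).holes := by
    rw [PartialConfig.holes, Nat.card_eq_fintype_card, Fintype.card_subtype]
  have hC : C.card = k ^ (s j).holes := by
    rw [card_piFinset_ite, Fintype.card_fin, hU]
  have hCfill : ∀ c ∈ C, (s j).IsFilling c := fun c hc u a hu => by
    have h1 := Fintype.mem_piFinset.1 hc u
    rw [if_neg (by simp [U, hu]), hu] at h1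
    simpa using h1
  have hle := hK (QuotientGroup.mk' (H (s j).n)) C fun c hc v => by
    obtain ⟨a, rfl⟩ := QuotientGroup.mk_surjective v
    obtain ⟨b, hb⟩ := hj c (hCfill c hc) a
    refine ⟨⟨b⁻¹ • x, subset_closure ⟨b⁻¹, rfl⟩⟩, fun g hg => ?_⟩
    have h1 : (b⁻¹ • x) g = x (b * g) := by
      change x (b⁻¹⁻¹ * g) = _
      rw [inv_inv]
    exact h1.trans (hb g hg)
  refine le_log_div (Fintype.card_pos (α := G ⧸ H (s j).n)) hle ?_
  have hk0 : (0 : ℝ) < k := by positivity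
  have hsize : (s j).size = Fintype.card (G ⧸ H (s j).n) := Nat.card_eq_fintype_card
  rw [hC, Nat.cast_pow, ← Real.exp_log (pow_pos hk0 _), Real.log_pow]
  refine Real.exp_le_exp.2 ?_
  have h2 := mul_le_mul_of_nonneg_right (hholes j).le (Real.log_natCast_nonneg k)
  rw [hsize] at h2
  refine le_trans (le_of_eq ?_) h2
  change _ * ((Fintype.card (G ⧸ H (s j).n) : ℕ) : ℝ) = _
  ring

end Toeplitz

end SoficDynamics

theorem mainTheorem1 {G : Type*} [Group G] [Countable G] [Infinite G]
    (H : ℕ → Subgroup G) (hnormal : ∀ n, (H n).Normal) (hindex : ∀ n, (H n).FiniteIndex)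
    (hanti : Antitone H) (hinf : ⨅ n, H n = ⊥)
    (k : ℕ) (hk : 2 ≤ k) (κ : ℝ) (hκ : κ ∈ Set.Ico (0 : ℝ) 1) :
    ∃ x : SoficDynamics.FullShift G k,
      SoficDynamics.IsToeplitz H x ∧
      SoficDynamics.IsSoficEntropy
        (SoficDynamics.cosetApproximation H hnormal hindex hanti hinf)
        (SoficDynamics.orbitClosure x)
        ((κ * Real.log k : ℝ) : EReal) := by
  have : Nonempty (Fin k) := ⟨⟨0, by omega⟩⟩
  obtain ⟨x, s, hmono, hext, hfill, hlt, hle, hwindow⟩ :=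
    SoficDynamics.exists_config_of_refinements hanti hinf (k := k) hκ
  refine ⟨x, Set.eq_univ_of_forall fun g => ?_, SoficDynamics.exists_isDynGenerating _,
    fun ρ hρ => le_antisymm ?_ ?_⟩
  · obtain ⟨j, hj⟩ := hfill g
    obtain ⟨a, ha⟩ := Option.ne_none_iff_exists'.1 hj
    refine Set.mem_iUnion.2 ⟨(s j).n, fun h hh => ?_⟩
    have hcoset : ((h⁻¹ * g : G) : G ⧸ H (s j).n) = g := by
      rw [QuotientGroup.mk_mul, (QuotientGroup.eq_one_iff _).2 (inv_mem hh), one_mul]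
    rw [hext j g a ha, hext j (h⁻¹ * g) a (by rw [hcoset, ha])]
  -- The index starts at `j + 1` because the initial empty configuration need not satisfy the upper
  -- bound on holes. The excess of one hole vanishes relative to the period.
  · have hsize : Tendsto (fun j => ((s (j + 1)).size : ℝ)) atTop atTop :=
      tendsto_natCast_atTop_atTop.comp
        ((SoficDynamics.tendsto_card_quotient hindex hanti hinf).comp
          (hmono.tendsto_atTop.comp (tendsto_add_atTop_nat 1)))
    have hlim : Tendsto (fun j => (κ + 1 / ((s (j + 1)).size : ℝ)) * Real.log k) atTop
        (𝓝 (κ * Real.log k)) := by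
      have := (hsize.inv_tendsto_atTop.const_add κ).mul_const (Real.log k)
      simpa using this
    refine ge_of_tendsto' ((continuous_coe_real_ereal.tendsto _).comp hlim) fun j => ?_
    refine (SoficDynamics.entropyOf_le_holes hnormal hindex hanti hinf hk (s (j + 1))
      (hext (j + 1)) ρ hρ).trans (EReal.coe_le_coe_iff.2 ?_)
    refine mul_le_mul_of_nonneg_right ?_ (Real.log_natCast_nonneg k)
    have hpos : (0 : ℝ) < (s (j + 1)).size := by exact_mod_cast Nat.card_pos
    rw [div_le_iff₀ hpos, add_mul, one_div, inv_mul_cancel₀ hpos.ne']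
    exact hle j
  · exact SoficDynamics.le_entropyOf_of_fillings hnormal hindex hanti hinf hk s hmono hlt hwindow
      ρ hρ
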